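/- Let $\mathbb K$ be a field of characteristic $0$, $n\ge 1$, and $V=\bigoplus_{\alpha\in\mathbb Z^n}V^\alpha$ a $\mathbb Z^n$-graded vector space over $\mathbb K$. Put $\langle x,y\rangle=\sum_i x_iy_i$ and $e_1=(1,0,\dots,0)\in\mathbb Z^n$, and use the same letter for a homogeneous vector or map and for its degree in signs. For $a\ge 0$ let $M^{(A,a)}(V)$ be the space of $(a+1)$-linear maps $V^{\times(a+1)}\to V$ of weight $A\in\mathbb Z^n$. Let $\downarrow V$ be $V$ with the gradation $(\downarrow V)^{\alpha}=V^{\alpha+e_1}$, let $\downarrow:V\to\downarrow V$ and $\uparrow:\downarrow V\to V$ be the identity maps, of weights $\mp e_1$, and let $s^{\otimes p}(v_1\otimes\dots\otimes v_p)=(-1)^{\sum_r (p-r)\langle e_1,v_r\rangle}\,s v_1\otimes\dots\otimes s v_p$ for $s\in\{\downarrow,\uparrow\}$. An unshuffle is a naturally ordered, possibly empty, subset $I$ of $(1,\dots,p)$; $V_I$ denotes the family, or tensor, of the $v_i$, $i\in I$, in increasing order; for disjoint $I,J$, $(-1)^{(I;J)}$ is the signature of the permutation $(I;J)\to I\cup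 J$ and $\varepsilon(I;J)$ the Koszul sign of $V_{(I;J)}\to V_{I\cup J}$; $I,J<K$ means that all elements of $I$ and $J$ are smaller than the first element $k_1$ of the nonempty unshuffle $K$. Unions $I\cup J\cup K$ below are disjoint. For $A\in M^{(A,a)}(V)$ put $Q^A_{a+1}=(-1)^{a(a+1)/2}\downarrow\circ A\circ\uparrow^{\otimes(a+1)}:(\downarrow V)^{\otimes(a+1)}\to\downarrow V$, and let $\phi(A)=Q^A$ be the linear endomorphism of weight $A+ae_1$ of $T(\downarrow V)=\bigoplus_{p\ge1}(\downarrow V)^{\otimes p}$ given on homogeneous $w_i\in\downarrow V$ by $$Q^A(w_1\otimes\dots\otimes w_p)=\sum_{I\cup J\cup K=(1,\dots,p),\ I,J<K,\ |J|=a}\varepsilon(I;J)\,(-1)^{\langle A+ae_1,W_I\rangle}\,W_I\otimes Q^A_{a+1}(W_J\otimes w_{k_1})\otimes W_{K\setminus k_1}.$$ ($Q^A$ is the coderivation of the graded dual Leibniz coalgebra $T(\downarrow V)$ whose only nonzero corestriction is $Q^A_{a+1}$.) The inverse $\phi^{-1}$, in arity $c+1$, is $Q\mapsto\uparrow\circ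 Q_{c+1}\circ\downarrow^{\otimes(c+1)}$, where $Q_{c+1}$ is the composite of $Q|_{(\downarrow V)^{\otimes(c+1)}}$ with the projection $T(\downarrow V)\to\downarrow V$. The stem bracket of $A\in M^{(A,a)}(V)$ and $B\in M^{(B,b)}(V)$, $a,b\ge0$, is $$[A,B]^{\otimes}=(-1)^{1+\langle ae_1,\,be_1+B\rangle}\,\phi^{-1}\big(Q^AQ^B-(-1)^{\langle A+ae_1,\,B+be_1\rangle}Q^BQ^A\big).$$ **Theorem.** For all $A\in M^{(A,a)}(V)$ and $B\in M^{(B,b)}(V)$ with $a,b\ge 0$, the stem bracket $[A,B]^{\otimes}$ lies in $M^{(A+B,a+b)}(V)$ and $$[A,B]^{\otimes}=j_AB-(-1)^{\langle (A,a),(B,b)\rangle}j_BA,\qquad \langle (A,a),(B,b)\rangle=\langle A,B\rangle+ab,$$ where, for homogeneous $v_1,\dots,v_{a+b+1}\in V$, $$(j_BA)(v_1,\dots,v_{a+b+1})=(-1)^{\langle A,B\rangle}\sum_{I\cup J\cup K=(1,\dots,a+b+1),\ I,J<K,\ |J|=b}(-1)^{\langle B,V_I\rangle+b|I|}(-1)^{(I;J)}\varepsilon(I;J)\,A\big(V_I\otimes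 B(V_J\otimes v_{k_1})\otimes V_{K\setminus k_1}\big),$$ and $j_AB$ is obtained by exchanging the roles of $(A,a)$ and $(B,b)$. If moreover $A$ and $B$ are graded skew-symmetric (exchanging adjacent homogeneous arguments $u,w$ multiplies the value by $-(-1)^{\langle u,w\rangle}$), then $[A,B]^{\otimes}$ is graded skew-symmetric and equals the graded Nijenhuis–Richardson bracket $[A,B]^{NR}=i_AB-(-1)^{\langle A,B\rangle+ab}\,i_BA$, where $$(i_BA)(v_1,\dots,v_{a+b+1})=(-1)^{\langle A,B\rangle}\sum_{S\cup L=(1,\dots,a+b+1),\ |S|=b+1,\ |L|=a}(-1)^{(S;L)}\varepsilon(S;L)\,A\big(B(V_S),V_L\big).$$ -/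

import Mathlib

open scoped DirectSum TensorProduct

noncomputable section

namespace Stem

/-! ### Graded vector spaces, desuspension, graded multilinear maps -/

section Graded

variable {n : ℕ} {K V N : Type*} [Field K] [AddCommGroup V] [Module K V]
  [AddCommGroup N] [Module K N]

/-- The degree `e₁ = (1, 0, …, 0)`. -/
def e₁ {n : ℕ} [NeZero n] : Fin n → ℤ := Pi.single 0 1

/-- The desuspension `↓V`: the same space with the shifted gradation `(↓V)^α = V^(α + e₁)`.
The maps `↓ : V → ↓V` (of weight `-e₁`) and `↑ : ↓V → V` (of weight `e₁`) are the identity of the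
underlying space. -/
def desusp [NeZero n] (𝒱 : (Fin n → ℤ) → Submodule K V) : (Fin n → ℤ) → Submodule K V :=
  fun α => 𝒱 (α + e₁)

theorem desusp_isInternal [NeZero n] (𝒱 : (Fin n → ℤ) → Submodule K V)
    [DirectSum.Decomposition 𝒱] : DirectSum.IsInternal (desusp 𝒱) := by
  have h := (DirectSum.isInternal_submodule_iff_iSupIndep_and_iSup_eq_top 𝒱).1
    (DirectSum.Decomposition.isInternal 𝒱)
  refine (DirectSum.isInternal_submodule_iff_iSupIndep_and_iSup_eq_top _).2 ⟨?_, ?_⟩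
  · exact h.1.comp (add_left_injective e₁)
  · rw [← h.2]
    exact (Equiv.addRight (e₁ : Fin n → ℤ)).iSup_comp (g := 𝒱)

instance desuspDecomposition [NeZero n] (𝒱 : (Fin n → ℤ) → Submodule K V)
    [DirectSum.Decomposition 𝒱] : DirectSum.Decomposition (desusp 𝒱) :=
  (desusp_isInternal 𝒱).chooseDecomposition

/-- `M^(A,a)(V)`: the `(a+1)`-linear maps on `V` of weight `α`. -/
def weightMaps (𝒱 : (Fin n → ℤ) → Submodule K V) (α : Fin n → ℤ) (a : ℕ) :
    Submodule K (MultilinearMap K (fun _ : Fin (a + 1) => V) V) where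
  carrier := {f | ∀ (d : Fin (a + 1) → Fin n → ℤ) (v : Fin (a + 1) → V),
    (∀ i, v i ∈ 𝒱 (d i)) → f v ∈ 𝒱 (∑ i, d i + α)}
  zero_mem' := fun _ _ _ => Submodule.zero_mem _
  add_mem' := fun hf hg d v hv => Submodule.add_mem _ (hf d v hv) (hg d v hv)
  smul_mem' := fun c _ hf d v hv => Submodule.smul_mem _ c (hf d v hv)

/-- The multilinear map that is given on `𝒱 (d 0) × ⋯ × 𝒱 (d (p-1))` by `F d`, for each tuple `d`
of degrees; see `homExtend_apply`. -/
def homExtend (𝒱 : (Fin n → ℤ) → Submodule K V) [DirectSum.Decomposition 𝒱] {p : ℕ}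
    (F : (Fin p → Fin n → ℤ) → MultilinearMap K (fun _ : Fin p => V) N) :
    MultilinearMap K (fun _ : Fin p => V) N :=
  (MultilinearMap.fromDirectSumEquiv (R := K) (M := fun (_ : Fin p) (α : Fin n → ℤ) => 𝒱 α)
    (fun d => (F d).compLinearMap fun i => (𝒱 (d i)).subtype)).compLinearMap
    fun _ => (DirectSum.decomposeLinearEquiv 𝒱).toLinearMap

theorem homExtend_apply (𝒱 : (Fin n → ℤ) → Submodule K V) [DirectSum.Decomposition 𝒱] {p : ℕ}
    (F : (Fin p → Fin n → ℤ) → MultilinearMap K (fun _ : Fin p => V) N)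
    (d : Fin p → Fin n → ℤ) (v : Fin p → V) (hv : ∀ i, v i ∈ 𝒱 (d i)) :
    homExtend 𝒱 F v = F d v := by
  have h : (fun i => DirectSum.decomposeLinearEquiv 𝒱 (v i)) =
      fun i => DirectSum.lof K (Fin n → ℤ) (fun α => 𝒱 α) (d i) ⟨v i, hv i⟩ := by
    funext i
    exact DirectSum.decompose_of_mem 𝒱 (hv i)
  simp only [homExtend, MultilinearMap.compLinearMap_apply, LinearEquiv.coe_coe]
  rw [h, MultilinearMap.fromDirectSumEquiv_lof]
  rfl

theorem homExtend_ext (𝒱 : (Fin n → ℤ) → Submodule K V) [DirectSum.Decomposition 𝒱] {p : ℕ}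
    {f g : MultilinearMap K (fun _ : Fin p => V) N}
    (h : ∀ (d : Fin p → Fin n → ℤ) (v : Fin p → V), (∀ i, v i ∈ 𝒱 (d i)) → f v = g v) : f = g := by
  have key : f.compLinearMap (fun _ => (DirectSum.decomposeLinearEquiv 𝒱).symm.toLinearMap) =
      g.compLinearMap (fun _ => (DirectSum.decomposeLinearEquiv 𝒱).symm.toLinearMap) := by
    refine MultilinearMap.directSum_ext fun d => ?_
    ext x
    simp only [MultilinearMap.compLinearMap_apply, LinearEquiv.coe_coe]
    refine h d _ fun i => ?_
    have : (DirectSum.decomposeLinearEquiv 𝒱).symm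
        (DirectSum.lof K (Fin n → ℤ) (fun α => 𝒱 α) (d i) (x i)) = x i :=
      DirectSum.decompose_symm_of 𝒱 (x i)
    rw [this]
    exact (x i).2
  ext v
  have := congrArg (fun F => F fun i => DirectSum.decomposeLinearEquiv 𝒱 (v i)) key
  simpa using this

/-- `f ∘ s^{⊗p}`, where `s` is `↓` (when `𝒱` is the gradation of `V`) or `↑` (when `𝒱` is that of
`↓V`): both have weight `∓e₁`, so that
`s^{⊗p}(v₁ ⊗ ⋯ ⊗ v_p) = (-1)^{∑ₛ (p-s)⟨e₁,vₛ⟩} s v₁ ⊗ ⋯ ⊗ s v_p`. -/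
def compShift [NeZero n] (𝒱 : (Fin n → ℤ) → Submodule K V) [DirectSum.Decomposition 𝒱] {p : ℕ}
    (f : MultilinearMap K (fun _ : Fin p => V) N) : MultilinearMap K (fun _ : Fin p => V) N :=
  homExtend 𝒱 fun d => (∑ s : Fin p, ((p : ℤ) - (s + 1)) * (e₁ ⬝ᵥ d s)).negOnePow • f

/-! ### Unshuffles and insertions -/

/-- The unshuffles `I ∪ J ∪ K = (1, …, c+1)` with `I, J < K` and `|J| = b`. As `K` is the interval
that starts with its first element `k₁`, they are given by `k₁` and by a set `J` of `b` elements
smaller than `k₁`; then `I` consists of the elements smaller than `k₁` that are not in `J`. -/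
abbrev Unshuffle (c b : ℕ) : Type :=
  {t : Fin (c + 1) × Finset (Fin (c + 1)) // (∀ j ∈ t.2, j < t.1) ∧ t.2.card = b}

namespace Unshuffle

variable {a b c : ℕ}

def k₁ (t : Unshuffle c b) : Fin (c + 1) := t.1.1

def J (t : Unshuffle c b) : Finset (Fin (c + 1)) := t.1.2

def I (t : Unshuffle c b) : Finset (Fin (c + 1)) := Finset.univ.filter fun i => i < t.k₁ ∧ i ∉ t.J

/-- The positions `J ∪ {k₁}` of the arguments of the inserted map. -/
def S (t : Unshuffle c b) : Finset (Fin (c + 1)) := insert t.k₁ t.J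

theorem card_S (t : Unshuffle c b) : t.S.card = b + 1 := by
  have h : t.k₁ ∉ t.J := fun h => lt_irrefl _ (t.2.1 _ h)
  rw [S, Finset.card_insert_of_notMem h, J, t.2.2]

theorem card_S_compl (h : a + b = c) (t : Unshuffle c b) : t.Sᶜ.card = a := by
  rw [Finset.card_compl, card_S, Fintype.card_fin]
  omega

theorem card_I_lt (h : a + b = c) (t : Unshuffle c b) : t.I.card < a + 1 := by
  rw [Nat.lt_succ_iff, ← card_S_compl h t]
  refine Finset.card_le_card fun i hi => ?_
  simp only [I, Finset.mem_filter, Finset.mem_univ, true_and] at hi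
  simp only [S, Finset.mem_compl, Finset.mem_insert, not_or]
  exact ⟨hi.1.ne, hi.2⟩

end Unshuffle

/-- `(v₁, …, v_{c+1}) ↦ f (x₁, …, x_s, q(v_S), x_{s+1}, …, x_a)`, where `v_S` is the family of the
`v_i`, `i ∈ S`, and `(x₁, …, x_a)` that of the `v_i`, `i ∉ S`, both in increasing order of `i`;
see `insertMap_apply`. -/
def insertMap {a b c : ℕ} (f : MultilinearMap K (fun _ : Fin (a + 1) => V) N)
    (q : MultilinearMap K (fun _ : Fin (b + 1) => V) V) (s : Fin (a + 1))
    (S : Finset (Fin (c + 1))) (hS : S.card = b + 1) (hS' : Sᶜ.card = a) :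
    MultilinearMap K (fun _ : Fin (c + 1) => V) N :=
  (MultilinearMap.uncurrySum (N := fun _ : Fin (b + 1) ⊕ Fin a => V)
    ((f.curryMid s).compMultilinearMap q)).domDomCongr (finSumEquivOfFinset hS hS')

theorem insertMap_apply {a b c : ℕ} (f : MultilinearMap K (fun _ : Fin (a + 1) => V) N)
    (q : MultilinearMap K (fun _ : Fin (b + 1) => V) V) (s : Fin (a + 1))
    (S : Finset (Fin (c + 1))) (hS : S.card = b + 1) (hS' : Sᶜ.card = a)
    (v : Fin (c + 1) → V) :
    insertMap f q s S hS hS' v =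
      f (s.insertNth (q fun i => v (S.orderEmbOfFin hS i)) fun i => v (Sᶜ.orderEmbOfFin hS' i)) := by
  simp [insertMap]

/-- `f(V_I ⊗ q(V_J ⊗ v_{k₁}) ⊗ V_{K∖k₁})`, as a function of `(v₁, …, v_{c+1})`. -/
def unshuffleInsert {a b c : ℕ} (h : a + b = c) (f : MultilinearMap K (fun _ : Fin (a + 1) => V) N)
    (q : MultilinearMap K (fun _ : Fin (b + 1) => V) V) (t : Unshuffle c b) :
    MultilinearMap K (fun _ : Fin (c + 1) => V) N :=
  insertMap f q ⟨t.I.card, t.card_I_lt h⟩ t.S t.card_S (t.card_S_compl h)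

/-- The number of inversions of `(I;J)`, for disjoint `I` and `J`: the sign `(-1)^{(I;J)}` of the
permutation `(I;J) → I ∪ J` is `-1` to this power. -/
def inversions {p : ℕ} (I J : Finset (Fin p)) : ℤ :=
  ∑ i ∈ I, ∑ j ∈ J, if j < i then 1 else 0

/-- The exponent of the Koszul sign `ε_V(I;J)` of `V_{(I;J)} → V_{I ∪ J}`, for disjoint `I`, `J` and
vectors `v_i` of degree `d i`: every inversion `(i, j)` contributes `⟨v_i, v_j⟩`. -/
def koszul {p : ℕ} (d : Fin p → Fin n → ℤ) (I J : Finset (Fin p)) : ℤ :=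
  ∑ i ∈ I, ∑ j ∈ J, if j < i then d i ⬝ᵥ d j else 0

end Graded

/-! ### The tensor space and its coderivations -/

section Tensor

variable {n : ℕ} {K V W : Type*} [Field K] [AddCommGroup V] [Module K V]
  [AddCommGroup W] [Module K W]

variable (K W) in
/-- The reduced tensor space `T(W) = ⨁_{p ≥ 1} W^{⊗p}`; the summand of index `c` is
`W^{⊗(c+1)}`. -/
abbrev RedTensor : Type _ := ⨁ c : ℕ, ⨂[K]^(c + 1) W

variable (K W) in
/-- `(w₁, …, w_{c+1}) ↦ w₁ ⊗ ⋯ ⊗ w_{c+1}` in `T(W)`. -/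
def incl (c : ℕ) : MultilinearMap K (fun _ : Fin (c + 1) => W) (RedTensor K W) :=
  (DirectSum.lof K ℕ (fun c => ⨂[K]^(c + 1) W) c).compMultilinearMap (PiTensorProduct.tprod K)

variable (K W) in
/-- The canonical projection `T(W) → W`. -/
def proj : RedTensor K W →ₗ[K] W :=
  (PiTensorProduct.subsingletonEquiv (R := K) (s := fun _ : Fin 1 => W) 0).toLinearMap ∘ₗ
    DirectSum.component K ℕ (fun c => ⨂[K]^(c + 1) W) 0

/-- The corestriction `Q_{c+1} : W^{⊗(c+1)} → W` of an endomorphism `Q` of `T(W)`. -/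
def corestriction (c : ℕ) (Q : RedTensor K W →ₗ[K] RedTensor K W) :
    MultilinearMap K (fun _ : Fin (c + 1) => W) W :=
  (proj K W ∘ₗ Q).compMultilinearMap (incl K W c)

/-- The coderivation of weight `δ` of `T(W)` whose only nonzero corestriction is
`q : W^{⊗(b+1)} → W`: it maps `v₁ ⊗ ⋯ ⊗ v_{c+1}` to the sum, over the unshuffles
`I ∪ J ∪ K = (1, …, c+1)` with `I, J < K` and `|J| = b`, of
`ε(I;J) (-1)^{⟨δ,V_I⟩} V_I ⊗ q(V_J ⊗ v_{k₁}) ⊗ V_{K∖k₁}`. -/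
def extension (𝒲 : (Fin n → ℤ) → Submodule K W) [DirectSum.Decomposition 𝒲] (δ : Fin n → ℤ)
    {b : ℕ} (q : MultilinearMap K (fun _ : Fin (b + 1) => W) W) :
    RedTensor K W →ₗ[K] RedTensor K W :=
  DirectSum.toModule K ℕ (RedTensor K W) fun c => PiTensorProduct.lift <|
    if h : b ≤ c then
      homExtend 𝒲 fun d => ∑ t : Unshuffle c b,
        (koszul d t.I t.J + δ ⬝ᵥ ∑ i ∈ t.I, d i).negOnePow •
          unshuffleInsert (Nat.sub_add_cancel h) (incl K W (c - b)) q t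
    else 0

theorem proj_incl (w : Fin 1 → W) : proj K W (incl K W 0 w) = w 0 := by
  simp only [proj, incl, LinearMap.compMultilinearMap_apply, LinearMap.comp_apply,
    LinearEquiv.coe_coe]
  erw [DirectSum.component.lof_self, PiTensorProduct.subsingletonEquiv_apply_tprod]

theorem extension_incl (𝒲 : (Fin n → ℤ) → Submodule K W) [DirectSum.Decomposition 𝒲]
    (δ : Fin n → ℤ) {b c : ℕ} (q : MultilinearMap K (fun _ : Fin (b + 1) => W) W) (h : b ≤ c)
    (d : Fin (c + 1) → Fin n → ℤ) (w : Fin (c + 1) → W) (hw : ∀ i, w i ∈ 𝒲 (d i)) :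
    extension 𝒲 δ q (incl K W c w) = ∑ t : Unshuffle c b,
      (koszul d t.I t.J + δ ⬝ᵥ ∑ i ∈ t.I, d i).negOnePow •
        unshuffleInsert (Nat.sub_add_cancel h) (incl K W (c - b)) q t w := by
  simp only [extension, incl, LinearMap.compMultilinearMap_apply]
  erw [DirectSum.toModule_lof]
  rw [PiTensorProduct.lift.tprod, dif_pos h, homExtend_apply 𝒲 _ d w hw]
  simp

theorem corestriction_extension (𝒲 : (Fin n → ℤ) → Submodule K W) [DirectSum.Decomposition 𝒲]
    (δ : Fin n → ℤ) {b : ℕ} (q : MultilinearMap K (fun _ : Fin (b + 1) => W) W) :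
    corestriction b (extension 𝒲 δ q) = q := by
  refine homExtend_ext 𝒲 fun d w hw => ?_
  have hk : ∀ t : Unshuffle b b, t.k₁ = Fin.last b := fun t => by
    have hc := Finset.card_le_card (fun j hj => Finset.mem_Iio.2 (t.2.1 j hj) :
      t.J ⊆ Finset.Iio t.k₁)
    have hJ : t.J.card = b := t.2.2
    rw [hJ, Fin.card_Iio] at hc
    exact Fin.ext (le_antisymm (Nat.lt_succ_iff.1 t.k₁.2) hc)
  have hS : ∀ t : Unshuffle b b, t.S = Finset.univ := fun t => by
    rw [← Finset.card_eq_iff_eq_univ, t.card_S, Fintype.card_fin]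
  have hJ : ∀ t : Unshuffle b b, t.J = Finset.univ.erase (Fin.last b) := fun t => by
    rw [← hS t, Unshuffle.S, hk t, Finset.erase_insert]
    exact fun h => absurd (t.2.1 _ h) (by rw [← hk t]; exact lt_irrefl _)
  have hI : ∀ t : Unshuffle b b, t.I = ∅ := fun t => by
    ext i
    simp only [Unshuffle.I, hk t, hJ t, Finset.mem_filter, Finset.mem_univ, Finset.mem_erase,
      true_and, and_true, not_not, Finset.notMem_empty, iff_false, not_and]
    exact fun h => h.ne
  have hterm : ∀ (a : ℕ) (h : a + b = b) (t : Unshuffle b b),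
      proj K W (unshuffleInsert h (incl K W a) q t w) = q w := fun a h t => by
    obtain rfl : a = 0 := by omega
    rw [unshuffleInsert, insertMap_apply, proj_incl]
    have h0 : (⟨t.I.card, t.card_I_lt h⟩ : Fin (0 + 1)) = 0 :=
      Subsingleton.elim (α := Fin 1) _ _
    have hemb : ∀ i, t.S.orderEmbOfFin t.card_S i = i := by
      have : ∀ (S : Finset (Fin (b + 1))) (hc : S.card = b + 1) (i), S.orderEmbOfFin hc i = i :=
        fun S hc i => by
          have := Subsingleton.elim ((S.orderEmbOfFin hc).strictMono.orderIsoOfSurjective _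
            (Finite.surjective_of_injective (S.orderEmbOfFin hc).injective))
            (OrderIso.refl (Fin (b + 1)))
          exact congrArg (fun e => e i) this
      exact this _ _
    simp only [h0, hemb]
    rfl
  have huniq : Subsingleton (Unshuffle b b) := ⟨fun t t' => Subtype.ext <| Prod.ext
    ((hk t).trans (hk t').symm) ((hJ t).trans (hJ t').symm)⟩
  let t₀ : Unshuffle b b := ⟨(Fin.last b, Finset.univ.erase (Fin.last b)),
    fun j hj => lt_of_le_of_ne (Fin.le_last j) (Finset.ne_of_mem_erase hj), by simp⟩
  rw [corestriction, LinearMap.compMultilinearMap_apply, LinearMap.comp_apply,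
    extension_incl 𝒲 δ q le_rfl d w hw, Fintype.sum_subsingleton _ t₀, hI t₀]
  simp [koszul, hterm]

/-- The graded commutator `[P, Q] = PQ - (-1)^{⟨γ,δ⟩} QP` of endomorphisms `P`, `Q` of weight `γ`,
`δ`. -/
def gradedCommutator {T : Type*} [AddCommGroup T] [Module K T] (γ δ : Fin n → ℤ)
    (P Q : T →ₗ[K] T) : T →ₗ[K] T :=
  P ∘ₗ Q - (γ ⬝ᵥ δ).negOnePow • (Q ∘ₗ P)

end Tensor

/-! ### The stem bracket -/

section Bracket

variable {n : ℕ} {K V : Type*} [Field K] [AddCommGroup V] [Module K V]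
  (𝒱 : (Fin n → ℤ) → Submodule K V) [DirectSum.Decomposition 𝒱]

/-- `φ_{(A,a)}(A)`: the coderivation of weight `α + a e₁` of `T(↓V)` that extends
`(-1)^{a(a+1)/2} ↓ ∘ A ∘ ↑^{⊗(a+1)}`. -/
def phi [NeZero n] (α : Fin n → ℤ) (a : ℕ) (A : MultilinearMap K (fun _ : Fin (a + 1) => V) V) :
    RedTensor K V →ₗ[K] RedTensor K V :=
  extension (desusp 𝒱) (α + a • e₁)
    (((a * (a + 1) / 2 : ℕ) : ℤ).negOnePow • compShift (desusp 𝒱) A)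

/-- The inverse of `φ` in arity `c + 1`: `Q ↦ ↑ ∘ Q_{c+1} ∘ ↓^{⊗(c+1)}`, that is, the corestriction
`Q_{c+1}` transported from `↓V` to `V`; see `phiInv_phi`. -/
def phiInv [NeZero n] (c : ℕ) (Q : RedTensor K V →ₗ[K] RedTensor K V) :
    MultilinearMap K (fun _ : Fin (c + 1) => V) V :=
  compShift 𝒱 (corestriction c Q)

/-- `φ⁻¹ ∘ φ = id`. -/
theorem phiInv_phi [NeZero n] (α : Fin n → ℤ) (a : ℕ)
    (A : MultilinearMap K (fun _ : Fin (a + 1) => V) V) :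
    phiInv 𝒱 a (phi 𝒱 α a A) = A := by
  refine homExtend_ext 𝒱 fun d v hv => ?_
  have hd : ∀ i, v i ∈ desusp 𝒱 (d i - e₁) := fun i => by
    simpa [desusp] using hv i
  rw [phiInv, compShift, homExtend_apply 𝒱 _ d v hv, smul_apply, phi,
    corestriction_extension, smul_apply, compShift,
    homExtend_apply (desusp 𝒱) _ _ v hd, smul_apply, smul_smul, smul_smul,
    ← Int.negOnePow_add, ← Int.negOnePow_add]
  rw [Int.negOnePow_even, one_smul]
  have he : (e₁ : Fin n → ℤ) ⬝ᵥ e₁ = 1 := by simp [e₁]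
  have hg : ∑ s : Fin (a + 1), (((a + 1 : ℕ) : ℤ) - ((s : ℕ) + 1)) =
      ((a * (a + 1) / 2 : ℕ) : ℤ) := by
    have h := Finset.sum_range_id (a + 1)
    rw [Nat.add_sub_cancel, mul_comm] at h
    rw [← h, ← Finset.sum_range_reflect, Finset.sum_range, Nat.cast_sum]
    refine Finset.sum_congr rfl fun s _ => ?_
    have := s.2
    omega
  simp only [dotProduct_sub, mul_sub, Finset.sum_sub_distrib, he, mul_one]
  rw [← Finset.sum_sub_distrib, hg]
  refine ⟨∑ s : Fin (a + 1), (((a + 1 : ℕ) : ℤ) - ((s : ℕ) + 1)) * (e₁ ⬝ᵥ d s), ?_⟩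
  ring

/-- The stem bracket of `A ∈ M^(α,a)(V)` and `B ∈ M^(β,b)(V)`:
`[A,B]^⊗ = (-1)^{1 + ⟨a e₁, b e₁ + B⟩} φ⁻¹([φ(A), φ(B)])`. -/
def stemBracket [NeZero n] (α : Fin n → ℤ) (a : ℕ) (β : Fin n → ℤ) (b : ℕ)
    (A : MultilinearMap K (fun _ : Fin (a + 1) => V) V)
    (B : MultilinearMap K (fun _ : Fin (b + 1) => V) V) :
    MultilinearMap K (fun _ : Fin (a + b + 1) => V) V :=
  (1 + (a • e₁) ⬝ᵥ (b • e₁ + β)).negOnePow •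
    phiInv 𝒱 (a + b) (gradedCommutator (α + a • e₁) (β + b • e₁) (phi 𝒱 α a A) (phi 𝒱 β b B))

/-- The insertion `j_B A` of `B` (of weight `β`) into `A` (of weight `α`); see `insertion_apply` for
its values on homogeneous vectors. -/
def insertion {a b c : ℕ} (h : a + b = c) (α β : Fin n → ℤ)
    (B : MultilinearMap K (fun _ : Fin (b + 1) => V) V)
    (A : MultilinearMap K (fun _ : Fin (a + 1) => V) V) :
    MultilinearMap K (fun _ : Fin (c + 1) => V) V :=
  (α ⬝ᵥ β).negOnePow • homExtend 𝒱 fun d => ∑ t : Unshuffle c b,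
    (β ⬝ᵥ (∑ i ∈ t.I, d i) + b * t.I.card + inversions t.I t.J + koszul d t.I t.J).negOnePow •
      unshuffleInsert h A B t

theorem insertion_apply {a b c : ℕ} (h : a + b = c) (α β : Fin n → ℤ)
    (B : MultilinearMap K (fun _ : Fin (b + 1) => V) V)
    (A : MultilinearMap K (fun _ : Fin (a + 1) => V) V)
    (d : Fin (c + 1) → Fin n → ℤ) (v : Fin (c + 1) → V) (hv : ∀ i, v i ∈ 𝒱 (d i)) :
    insertion 𝒱 h α β B A v = (α ⬝ᵥ β).negOnePow • ∑ t : Unshuffle c b,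
      (β ⬝ᵥ (∑ i ∈ t.I, d i) + b * t.I.card + inversions t.I t.J + koszul d t.I t.J).negOnePow •
        unshuffleInsert h A B t v := by
  rw [insertion, smul_apply, homExtend_apply 𝒱 _ d v hv]
  simp

/-! ### Graded skew-symmetric maps and the Nijenhuis–Richardson bracket -/

/-- Graded skew-symmetry. -/
def IsGradedSkew {p : ℕ} (f : MultilinearMap K (fun _ : Fin p => V) V) : Prop :=
  ∀ (d : Fin p → Fin n → ℤ) (v : Fin p → V), (∀ i, v i ∈ 𝒱 (d i)) →
    ∀ i j : Fin p, (i : ℕ) + 1 = j →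
      f (v ∘ Equiv.swap i j) = -((d i ⬝ᵥ d j).negOnePow • f v)

/-- The interior product
`(i_B A)(v₁, …, v_{c+1}) = (-1)^{⟨A,B⟩} ∑ (-1)^{(S;L)} ε_V(S;L) A(B(V_S), V_L)`, the sum being over
the unshuffles `S ∪ L = (1, …, c+1)` with `|S| = b + 1`, `|L| = a`. -/
def interior {a b c : ℕ} (h : a + b = c) (α β : Fin n → ℤ)
    (B : MultilinearMap K (fun _ : Fin (b + 1) => V) V)
    (A : MultilinearMap K (fun _ : Fin (a + 1) => V) V) :
    MultilinearMap K (fun _ : Fin (c + 1) => V) V :=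
  (α ⬝ᵥ β).negOnePow • homExtend 𝒱 fun d =>
    ∑ S : {S : Finset (Fin (c + 1)) // S.card = b + 1},
      (inversions S.1 S.1ᶜ + koszul d S.1 S.1ᶜ).negOnePow •
        insertMap A B 0 S.1 S.2
          (by rw [Finset.card_compl, S.2, Fintype.card_fin]; omega)

/-- The graded Nijenhuis–Richardson bracket
`[A,B]^NR = i_A B - (-1)^{⟨(A,a),(B,b)⟩} i_B A`. -/
def nrBracket (α : Fin n → ℤ) (a : ℕ) (β : Fin n → ℤ) (b : ℕ)
    (A : MultilinearMap K (fun _ : Fin (a + 1) => V) V)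
    (B : MultilinearMap K (fun _ : Fin (b + 1) => V) V) :
    MultilinearMap K (fun _ : Fin (a + b + 1) => V) V :=
  interior 𝒱 (Nat.add_comm b a) β α A B -
    (α ⬝ᵥ β + a * b).negOnePow • interior 𝒱 rfl α β B A

end Bracket

end Stem

end

/-! Everything is compared on homogeneous vectors, where `homExtend_ext` reduces equality of
multilinear maps to equality of signs. The map `Q^B` sends a tensor of length `a + b + 1` to tensors
of length `a + 1`, so the corestriction of `Q^A Q^B` in that arity applies `Q^A_{a+1}` to the terms
of `Q^B` (`corestriction_comp`). Thus `φ⁻¹(Q^A Q^B)` and `j_B A` have the same terms, indexed by the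
same unshuffles, and only signs remain.

The signs come from three suspensions, from the Koszul sign in the shifted degrees and from moving
`Q^B` past `W_I`. In the total exponent every pairing of `e₁` with the degree of an argument has an
even coefficient; what survives is the exponent of `j_B A` and the constant `a⟨e₁,β⟩`
(`even_stem_sign`). The prefactor of the stem bracket removes this constant, which gives
`stemBracket_eq`.

For skew-symmetric `A`, moving the value of `B` to the first slot turns each term of `j_B A` into
one of `i_B A`; an unshuffle is determined by `S = J ∪ {k₁}`, because `k₁` is the largest element of
`S` (`insertion_eq_interior`). Skew-symmetry of `i_B A` is checked on adjacent transpositions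
(`interior_isGradedSkew`): if both exchanged arguments enter `B`, or both stay outside, use the
symmetry of `B` or of `A`; otherwise the terms are permuted and one inversion changes. -/

noncomputable section

namespace Stem

/-! ### Sums and positions -/

section Positions

variable {p k : ℕ} {M : Type*} [AddCommMonoid M]

theorem card_filter_lt_orderEmbOfFin (S : Finset (Fin p)) (h : S.card = k) (i : Fin k) :
    (S.filter fun x => x < S.orderEmbOfFin h i).card = i := by
  have hS : (S.filter fun x => x < S.orderEmbOfFin h i) =
      (Finset.univ.map (S.orderEmbOfFin h).toEmbedding).filter
        fun x => x < S.orderEmbOfFin h i := by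
    rw [Finset.map_orderEmbOfFin_univ]
  rw [hS, Finset.filter_map, Finset.card_map]
  have : (Finset.univ.filter ((fun x => x < S.orderEmbOfFin h i) ∘
      (S.orderEmbOfFin h).toEmbedding)) = Finset.Iio i := by
    ext j
    simp
  rw [this, Fin.card_Iio]

/-- Suspension signs weight an argument by its position in a subfamily. Counting the smaller
elements makes that position a function of the element, so that weights from different subfamilies
can be added termwise. -/
theorem sum_orderEmbOfFin (S : Finset (Fin p)) (h : S.card = k) (F : ℕ → Fin p → M) :
    ∑ i : Fin k, F i (S.orderEmbOfFin h i) =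
      ∑ l ∈ S, F (S.filter fun x => x < l).card l := by
  conv_rhs => rw [← Finset.map_orderEmbOfFin_univ S h]
  rw [Finset.sum_map]
  refine Finset.sum_congr rfl fun i _ => ?_
  rw [Finset.map_orderEmbOfFin_univ]
  exact congrArg (fun m => F m _) (card_filter_lt_orderEmbOfFin S h i).symm

theorem card_filter_lt_add_compl (S : Finset (Fin p)) (l : Fin p) :
    (S.filter fun x => x < l).card + (Sᶜ.filter fun x => x < l).card = l := by
  rw [← Finset.card_union_of_disjoint
    (Finset.disjoint_filter_filter disjoint_compl_right), ← Finset.filter_union,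
    Finset.union_compl, Finset.filter_gt_eq_Iio, Fin.card_Iio]

theorem sum_insertNth {a : ℕ} {N : Type*} (s : Fin (a + 1)) (x : N) (y : Fin a → N)
    (F : Fin (a + 1) → N → M) :
    ∑ r, F r (s.insertNth (α := fun _ => N) x y r) = F s x + ∑ i, F (s.succAbove i) (y i) := by
  rw [Fin.sum_univ_succAbove _ s]
  simp

end Positions

namespace Unshuffle

variable {a b c : ℕ} (t : Unshuffle c b)

theorem mem_S {l : Fin (c + 1)} : l ∈ t.S ↔ l = t.k₁ ∨ l ∈ t.J := by
  simp [S]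

theorem le_k₁ {l : Fin (c + 1)} (hl : l ∈ t.S) : l ≤ t.k₁ := by
  rcases t.mem_S.1 hl with rfl | hl
  · exact le_rfl
  · exact (t.2.1 l hl).le

theorem k₁_mem_S : t.k₁ ∈ t.S := t.mem_S.2 (Or.inl rfl)

theorem mem_I {l : Fin (c + 1)} : l ∈ t.I ↔ l ∈ t.Sᶜ ∧ l < t.k₁ := by
  simp only [I, S, Finset.mem_filter, Finset.mem_univ, true_and, Finset.mem_compl,
    Finset.mem_insert, not_or]
  exact ⟨fun h => ⟨⟨h.1.ne, h.2⟩, h.1⟩, fun h => ⟨h.2, h.1.2⟩⟩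

theorem I_eq_filter : t.I = t.Sᶜ.filter fun l => l < t.k₁ := by
  ext l
  simp only [mem_I, Finset.mem_filter]

theorem lt_k₁ {l : Fin (c + 1)} (hl : l ∈ t.I) : l < t.k₁ := (t.mem_I.1 hl).2

theorem k₁_lt {l : Fin (c + 1)} (hl : l ∈ t.Sᶜ) (hl' : l ∉ t.I) : t.k₁ < l := by
  refine lt_of_le_of_ne (not_lt.1 fun h => hl' (t.mem_I.2 ⟨hl, h⟩)) ?_
  rintro rfl
  exact Finset.mem_compl.1 hl t.k₁_mem_S

theorem sum_S_inversion {M : Type*} [AddCommMonoid M] (g : Fin (c + 1) → Fin (c + 1) → M) :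
    ∑ i ∈ t.I, ∑ j ∈ t.J, (if j < i then g i j else 0) =
      ∑ i ∈ t.I, ∑ j ∈ t.S, (if j < i then g i j else 0) := by
  refine Finset.sum_congr rfl fun i hi => ?_
  have h : t.k₁ ∉ t.J := fun h => lt_irrefl _ (t.2.1 _ h)
  rw [S, Finset.sum_insert h, if_neg (t.lt_k₁ hi).le.not_gt, zero_add]

theorem inversions_I_J : inversions t.I t.J = inversions t.I t.S :=
  t.sum_S_inversion fun _ _ => 1

theorem koszul_I_J {n : ℕ} (d : Fin (c + 1) → Fin n → ℤ) :
    koszul d t.I t.J = koszul d t.I t.S :=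
  t.sum_S_inversion fun i j => d i ⬝ᵥ d j

/-- The `i`-th argument outside of `S` stands after the inserted one if and only if it lies
beyond `k₁`. -/
theorem val_succAbove (h : a + b = c) (i : Fin a) :
    (((⟨t.I.card, t.card_I_lt h⟩ : Fin (a + 1)).succAbove i : Fin (a + 1)) : ℕ) =
      i + if t.k₁ < t.Sᶜ.orderEmbOfFin (t.card_S_compl h) i then 1 else 0 := by
  have hi := card_filter_lt_orderEmbOfFin t.Sᶜ (t.card_S_compl h) i
  set l := t.Sᶜ.orderEmbOfFin (t.card_S_compl h) i with hl
  have hmem : l ∈ t.Sᶜ := Finset.orderEmbOfFin_mem _ _ _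
  by_cases hlt : t.k₁ < l
  · rw [if_pos hlt, Fin.succAbove_of_le_castSucc, Fin.val_succ]
    rw [Fin.le_def, Fin.val_castSucc, ← hi]
    exact Finset.card_le_card fun x hx =>
      Finset.mem_filter.2 ⟨(t.mem_I.1 hx).1, (t.lt_k₁ hx).trans hlt⟩
  · rw [if_neg hlt, Fin.succAbove_of_castSucc_lt, Fin.val_castSucc, add_zero]
    have hI : l ∈ t.I := by
      by_contra hI
      exact hlt (t.k₁_lt hmem hI)
    rw [Fin.lt_def, Fin.val_castSucc, ← hi]
    refine Finset.card_lt_card (Finset.ssubset_iff_of_subset ?_ |>.2 ⟨l, hI, by simp⟩)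
    intro x hx
    simp only [Finset.mem_filter] at hx
    exact t.mem_I.2 ⟨hx.1, hx.2.trans (t.lt_k₁ hI)⟩

end Unshuffle

/-! ### The sign of a term of the stem bracket -/

section Sign

variable {n : ℕ} [NeZero n]

theorem e₁_dotProduct_e₁ : (e₁ : Fin n → ℤ) ⬝ᵥ e₁ = 1 := by simp [e₁]

theorem sum_shift (a : ℕ) :
    ∑ s : Fin (a + 1), (((a + 1 : ℕ) : ℤ) - ((s : ℕ) + 1)) = ((a * (a + 1) / 2 : ℕ) : ℤ) := by
  have h := Finset.sum_range_id (a + 1)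
  rw [Nat.add_sub_cancel, mul_comm] at h
  rw [← h, ← Finset.sum_range_reflect, Finset.sum_range, Nat.cast_sum]
  refine Finset.sum_congr rfl fun s _ => ?_
  have := s.2
  omega

/-- For each inversion, expand `⟨d i - e₁, d j - e₁⟩`. The term `⟨e₁,e₁⟩ = 1` yields the signature
of the permutation, and the mixed terms count the inversions in which each index takes part. -/
theorem koszul_sub_e₁ {p : ℕ} (d : Fin p → Fin n → ℤ) (I J : Finset (Fin p)) :
    koszul (fun i => d i - e₁) I J = koszul d I J + inversions I J -
      ∑ i ∈ I, ((J.filter fun j => j < i).card : ℤ) * (e₁ ⬝ᵥ d i) -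
      ∑ j ∈ J, ((I.filter fun i => j < i).card : ℤ) * (e₁ ⬝ᵥ d j) := by
  have h₁ : ∑ i ∈ I, ((J.filter fun j => j < i).card : ℤ) * (e₁ ⬝ᵥ d i) =
      ∑ i ∈ I, ∑ j ∈ J, if j < i then e₁ ⬝ᵥ d i else 0 := by
    refine Finset.sum_congr rfl fun i _ => ?_
    rw [← Finset.sum_filter, Finset.sum_const, nsmul_eq_mul]
  have h₂ : ∑ j ∈ J, ((I.filter fun i => j < i).card : ℤ) * (e₁ ⬝ᵥ d j) =
      ∑ i ∈ I, ∑ j ∈ J, if j < i then e₁ ⬝ᵥ d j else 0 := by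
    rw [Finset.sum_comm]
    refine Finset.sum_congr rfl fun i _ => ?_
    rw [← Finset.sum_filter, Finset.sum_const, nsmul_eq_mul]
  rw [h₁, h₂, koszul, koszul, inversions]
  simp only [← Finset.sum_add_distrib, ← Finset.sum_sub_distrib]
  refine Finset.sum_congr rfl fun i _ => Finset.sum_congr rfl fun j _ => ?_
  split_ifs
  · rw [sub_dotProduct, dotProduct_sub, dotProduct_sub, e₁_dotProduct_e₁,
      dotProduct_comm (d i) e₁]
    ring
  · ring

/-- The sign bookkeeping of the theorem: collect the coefficient of `⟨e₁, d l⟩` for each `l`,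
separately on `S` and on its complement, and check its parity. -/
theorem even_stem_sign {a b c : ℕ} (h : a + b = c) (β : Fin n → ℤ) (t : Unshuffle c b)
    (d : Fin (c + 1) → Fin n → ℤ) :
    Even ((∑ s : Fin (c + 1), (((c + 1 : ℕ) : ℤ) - ((s : ℕ) + 1)) * (e₁ ⬝ᵥ d s) +
        (koszul (fun i => d i - e₁) t.I t.J + (β + b • e₁) ⬝ᵥ ∑ i ∈ t.I, (d i - e₁)) +
        ∑ r : Fin (a + 1), (((a + 1 : ℕ) : ℤ) - ((r : ℕ) + 1)) *
          (e₁ ⬝ᵥ (⟨t.I.card, t.card_I_lt h⟩ : Fin (a + 1)).insertNth (α := fun _ => Fin n → ℤ)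
            (∑ i, d (t.S.orderEmbOfFin t.card_S i) + β)
            (fun i => d (t.Sᶜ.orderEmbOfFin (t.card_S_compl h) i)) r) +
        ∑ r : Fin (b + 1), (((b + 1 : ℕ) : ℤ) - ((r : ℕ) + 1)) *
          (e₁ ⬝ᵥ d (t.S.orderEmbOfFin t.card_S r))) -
      (a * (e₁ ⬝ᵥ β) + (β ⬝ᵥ (∑ i ∈ t.I, d i) + b * t.I.card + inversions t.I t.J +
        koszul d t.I t.J))) := by
  rw [sum_insertNth _ _ _ fun r (x : Fin n → ℤ) =>
      (((a + 1 : ℕ) : ℤ) - ((r : ℕ) + 1)) * (e₁ ⬝ᵥ x),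
    koszul_sub_e₁, t.koszul_I_J, t.inversions_I_J]
  simp only [t.val_succAbove h]
  rw [sum_orderEmbOfFin t.Sᶜ (t.card_S_compl h) fun i l =>
      (((a + 1 : ℕ) : ℤ) - ((i + if t.k₁ < l then 1 else 0 : ℕ) + 1)) * (e₁ ⬝ᵥ d l),
    sum_orderEmbOfFin t.S t.card_S fun i l => (((b + 1 : ℕ) : ℤ) - (i + 1)) * (e₁ ⬝ᵥ d l),
    sum_orderEmbOfFin t.S t.card_S fun _ l => d l,
    ← Finset.sum_add_sum_compl t.S fun s : Fin (c + 1) =>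
      (((c + 1 : ℕ) : ℤ) - ((s : ℕ) + 1)) * (e₁ ⬝ᵥ d s)]
  -- No element of `I` lies beyond `k₁`, so adding `k₁` to `J` creates no inversion.
  have hJI : ∑ j ∈ t.J, ((t.I.filter fun i => j < i).card : ℤ) * (e₁ ⬝ᵥ d j) =
      ∑ j ∈ t.S, ((t.I.filter fun i => j < i).card : ℤ) * (e₁ ⬝ᵥ d j) := by
    have hk : t.k₁ ∉ t.J := fun h => lt_irrefl _ (t.2.1 _ h)
    have : (t.I.filter fun i => t.k₁ < i) = ∅ :=
      Finset.filter_eq_empty_iff.2 fun i hi => (t.lt_k₁ hi).le.not_gt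
    rw [Unshuffle.S, Finset.sum_insert hk, this]
    simp
  have hIJ : ∑ i ∈ t.I, ((t.J.filter fun j => j < i).card : ℤ) * (e₁ ⬝ᵥ d i) =
      ∑ i ∈ t.I, ((t.S.filter fun j => j < i).card : ℤ) * (e₁ ⬝ᵥ d i) := by
    refine Finset.sum_congr rfl fun i hi => ?_
    rw [Unshuffle.S, Finset.filter_insert, if_neg (t.lt_k₁ hi).le.not_gt]
  have hI : ∀ f : Fin (c + 1) → ℤ, ∑ i ∈ t.I, f i = ∑ l ∈ t.Sᶜ, if l < t.k₁ then f l else 0 :=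
    fun f => by rw [t.I_eq_filter, Finset.sum_filter]
  have hβ : (β + b • e₁) ⬝ᵥ ∑ i ∈ t.I, (d i - e₁) =
      β ⬝ᵥ (∑ i ∈ t.I, d i) - t.I.card * (e₁ ⬝ᵥ β) - b * t.I.card +
        ∑ i ∈ t.I, b * (e₁ ⬝ᵥ d i) := by
    rw [Finset.sum_sub_distrib, Finset.sum_const, add_dotProduct, dotProduct_sub, dotProduct_sub,
      smul_dotProduct, smul_dotProduct, dotProduct_smul, dotProduct_smul, e₁_dotProduct_e₁,
      dotProduct_sum, dotProduct_sum, Finset.smul_sum, dotProduct_comm β e₁]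
    simp only [nsmul_eq_mul]
    ring
  -- The four contributions come from `↓` on all arguments, the Koszul sign, `↑` for `A` at slot
  -- `|I|`, where the degree of the value of `B` contains `d l`, and `↑` for `B`. Elements outside
  -- `S` and below `l` all lie in `I`.
  have hS : Even (∑ l ∈ t.S, ((c - (l : ℕ) : ℤ) - ((t.I.filter fun i => l < i).card : ℤ) +
      (a - t.I.card : ℤ) + (b - ((t.S.filter fun x => x < l).card : ℤ))) * (e₁ ⬝ᵥ d l)) := by
    refine Finset.even_sum _ fun l hl => Even.mul_right ?_ _
    have h₁ := card_filter_lt_add_compl t.S l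
    have h₂ : (t.Sᶜ.filter fun x => x < l) = t.I.filter fun x => x < l := by
      ext x
      simp only [Finset.mem_filter, t.mem_I, and_assoc, and_congr_right_iff]
      exact fun _ => ⟨fun hx => ⟨hx.trans_le (t.le_k₁ hl), hx⟩, fun hx => hx.2⟩
    have h₃ := Finset.card_filter_add_card_filter_not (s := t.I) fun x => x < l
    have h₄ : (t.I.filter fun x => ¬ x < l) = t.I.filter fun x => l < x := by
      refine Finset.filter_congr fun x hx => ?_
      have : x ≠ l := by
        rintro rfl
        exact Finset.mem_compl.1 (t.mem_I.1 hx).1 hl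
      exact ⟨fun h => lt_of_le_of_ne (not_lt.1 h) this.symm, fun h => h.le.not_gt⟩
    rw [h₂] at h₁
    rw [h₄] at h₃
    refine ⟨c - t.I.card - (t.S.filter fun x => x < l).card, ?_⟩
    omega
  -- Below `k₁` the Koszul sign and the passage of `be₁` contribute too. Beyond `k₁` they do not,
  -- but the argument's slot in `A` is shifted by one and all `b + 1` elements of `S` precede it.
  have hSc : Even (∑ l ∈ t.Sᶜ, ((c - (l : ℕ) : ℤ) +
      (if l < t.k₁ then b - ((t.S.filter fun x => x < l).card : ℤ) else 0) +
      (a - ((t.Sᶜ.filter fun x => x < l).card + if t.k₁ < l then 1 else 0 : ℕ) : ℤ)) *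
        (e₁ ⬝ᵥ d l)) := by
    refine Finset.even_sum _ fun l hl => Even.mul_right ?_ _
    have h₁ := card_filter_lt_add_compl t.S l
    by_cases hlt : l < t.k₁
    · rw [if_pos hlt, if_neg hlt.le.not_gt]
      refine ⟨c - (l : ℕ), ?_⟩
      push_cast
      omega
    · have hk := t.k₁_lt hl fun h => hlt (t.lt_k₁ h)
      rw [if_neg hlt, if_pos hk]
      have h₂ : (t.S.filter fun x => x < l) = t.S :=
        Finset.filter_true_of_mem fun x hx => (t.le_k₁ hx).trans_lt hk
      rw [h₂, t.card_S] at h₁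
      refine ⟨a - 1 - (t.Sᶜ.filter fun x => x < l).card, ?_⟩
      push_cast
      omega
  rw [hJI, hIJ, hβ, hI, hI]
  -- The even correction absorbs the terms without `d`: `|I|⟨e₁,β⟩` occurs twice with the same sign,
  -- and `b|I|` has opposite signs in the two exponents.
  have key := (hS.add hSc).sub (even_two_mul ((t.I.card : ℤ) * (e₁ ⬝ᵥ β) + b * t.I.card))
  have eS : ∑ l ∈ t.S, ((c - (l : ℕ) : ℤ) - ((t.I.filter fun i => l < i).card : ℤ) +
      (a - t.I.card : ℤ) + (b - ((t.S.filter fun x => x < l).card : ℤ))) * (e₁ ⬝ᵥ d l) =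
      ∑ l ∈ t.S, (((c + 1 : ℕ) : ℤ) - ((l : ℕ) + 1)) * (e₁ ⬝ᵥ d l) -
      ∑ l ∈ t.S, ((t.I.filter fun i => l < i).card : ℤ) * (e₁ ⬝ᵥ d l) +
      (a - t.I.card : ℤ) * ∑ l ∈ t.S, e₁ ⬝ᵥ d l +
      ∑ l ∈ t.S, (((b + 1 : ℕ) : ℤ) - ((t.S.filter fun x => x < l).card + 1)) * (e₁ ⬝ᵥ d l) := by
    rw [Finset.mul_sum, ← Finset.sum_sub_distrib, ← Finset.sum_add_distrib,
      ← Finset.sum_add_distrib]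
    refine Finset.sum_congr rfl fun l _ => ?_
    push_cast
    ring
  have eSc : ∑ l ∈ t.Sᶜ, ((c - (l : ℕ) : ℤ) +
      (if l < t.k₁ then b - ((t.S.filter fun x => x < l).card : ℤ) else 0) +
      (a - ((t.Sᶜ.filter fun x => x < l).card + if t.k₁ < l then 1 else 0 : ℕ) : ℤ)) *
        (e₁ ⬝ᵥ d l) =
      ∑ l ∈ t.Sᶜ, (((c + 1 : ℕ) : ℤ) - ((l : ℕ) + 1)) * (e₁ ⬝ᵥ d l) -
      (∑ l ∈ t.Sᶜ, if l < t.k₁ then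
        ((t.S.filter fun x => x < l).card : ℤ) * (e₁ ⬝ᵥ d l) else 0) +
      (∑ l ∈ t.Sᶜ, if l < t.k₁ then b * (e₁ ⬝ᵥ d l) else 0) +
      ∑ l ∈ t.Sᶜ, (((a + 1 : ℕ) : ℤ) - (((t.Sᶜ.filter fun x => x < l).card +
        if t.k₁ < l then 1 else 0 : ℕ) + 1)) * (e₁ ⬝ᵥ d l) := by
    rw [← Finset.sum_sub_distrib, ← Finset.sum_add_distrib, ← Finset.sum_add_distrib]
    refine Finset.sum_congr rfl fun l _ => ?_
    by_cases hl : l < t.k₁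
    · simp only [if_pos hl]
      push_cast
      ring
    · simp only [if_neg hl]
      push_cast
      ring
  rw [eS, eSc] at key
  obtain ⟨r, hr⟩ := key
  refine ⟨r, Eq.trans ?_ hr⟩
  have hd : e₁ ⬝ᵥ ∑ l ∈ t.S, d l = ∑ l ∈ t.S, e₁ ⬝ᵥ d l := dotProduct_sum _ _ _
  rw [dotProduct_add, hd]
  push_cast
  ring

end Sign

/-! ### The stem bracket in terms of insertions -/

section StemFormula

variable {n : ℕ} {K V N : Type*} [Field K] [AddCommGroup V] [Module K V]
  [AddCommGroup N] [Module K N]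

theorem map_insertNth_units_smul {a : ℕ} (f : MultilinearMap K (fun _ : Fin (a + 1) => V) N)
    (s : Fin (a + 1)) (ε : ℤˣ) (x : V) (y : Fin a → V) :
    f (s.insertNth (α := fun _ => V) (ε • x) y) =
      ε • f (s.insertNth (α := fun _ => V) x y) := by
  rw [← MultilinearMap.curryMid_apply_apply, ← MultilinearMap.curryMid_apply_apply,
    Units.smul_def, Units.smul_def, map_zsmul]
  rfl

theorem insertNth_mem {a : ℕ} {𝒱 : (Fin n → ℤ) → Submodule K V} {s : Fin (a + 1)} {x : V}
    {δ : Fin n → ℤ} {y : Fin a → V} {d : Fin a → Fin n → ℤ} (hx : x ∈ 𝒱 δ)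
    (hy : ∀ i, y i ∈ 𝒱 (d i)) (r : Fin (a + 1)) :
    s.insertNth (α := fun _ => V) x y r ∈
      𝒱 (s.insertNth (α := fun _ => Fin n → ℤ) δ d r) := by
  revert r
  rw [Fin.forall_iff_succAbove s]
  simpa using ⟨hx, hy⟩

/-- Each term of the inner coderivation already has tensor length `a + 1`, and there the outer one
followed by the projection is `p` itself. -/
theorem corestriction_comp (𝒲 : (Fin n → ℤ) → Submodule K V) [DirectSum.Decomposition 𝒲]
    (γ δ : Fin n → ℤ) {a b c : ℕ} (h : a + b = c)
    (p : MultilinearMap K (fun _ : Fin (a + 1) => V) V)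
    (q : MultilinearMap K (fun _ : Fin (b + 1) => V) V)
    (d : Fin (c + 1) → Fin n → ℤ) (w : Fin (c + 1) → V) (hw : ∀ i, w i ∈ 𝒲 (d i)) :
    corestriction c (extension 𝒲 γ p ∘ₗ extension 𝒲 δ q) w = ∑ t : Unshuffle c b,
      (koszul d t.I t.J + δ ⬝ᵥ ∑ i ∈ t.I, d i).negOnePow • unshuffleInsert h p q t w := by
  -- `extension` lands in the summand of index `c - b`; the substitution makes the arities agree on
  -- the nose.
  obtain rfl : a = c - b := by omega
  rw [corestriction, LinearMap.compMultilinearMap_apply, LinearMap.comp_apply,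
    LinearMap.comp_apply, extension_incl 𝒲 δ q (by omega) d w hw, map_sum, map_sum]
  refine Finset.sum_congr rfl fun t _ => ?_
  rw [Units.smul_def, Units.smul_def, map_zsmul, map_zsmul]
  congr 1
  rw [unshuffleInsert, unshuffleInsert, insertMap_apply, insertMap_apply]
  conv_rhs => rw [← corestriction_extension 𝒲 γ p]
  rfl

theorem mem_desusp [NeZero n] (𝒱 : (Fin n → ℤ) → Submodule K V) {δ : Fin n → ℤ} {x : V}
    (hx : x ∈ 𝒱 δ) : x ∈ desusp 𝒱 (δ - e₁) := by
  simpa [desusp] using hx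

variable [NeZero n] (𝒱 : (Fin n → ℤ) → Submodule K V) [DirectSum.Decomposition 𝒱]

/-- The factor `(-1)^{a(a+1)/2}` is exactly what appears when the suspension sign is rewritten from
degrees in `↓V` to degrees in `V`. -/
theorem signed_compShift_desusp_apply {a : ℕ} (A : MultilinearMap K (fun _ : Fin (a + 1) => V) N)
    (d : Fin (a + 1) → Fin n → ℤ) (w : Fin (a + 1) → V) (hw : ∀ i, w i ∈ 𝒱 (d i)) :
    (((a * (a + 1) / 2 : ℕ) : ℤ).negOnePow • compShift (desusp 𝒱) A) w =
      (∑ s : Fin (a + 1), (((a + 1 : ℕ) : ℤ) - ((s : ℕ) + 1)) * (e₁ ⬝ᵥ d s)).negOnePow • A w := by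
  rw [smul_apply, compShift,
    homExtend_apply (desusp 𝒱) _ _ w fun i => mem_desusp 𝒱 (hw i), smul_apply, smul_smul,
    ← Int.negOnePow_add]
  simp only [dotProduct_sub, mul_sub, Finset.sum_sub_distrib, e₁_dotProduct_e₁, mul_one]
  rw [← Finset.sum_sub_distrib, sum_shift, add_sub_cancel]

theorem phiInv_phi_comp_phi {a b c : ℕ} (h : a + b = c) (α β : Fin n → ℤ)
    (A : MultilinearMap K (fun _ : Fin (a + 1) => V) V)
    (B : MultilinearMap K (fun _ : Fin (b + 1) => V) V) (hB : B ∈ weightMaps 𝒱 β b) :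
    phiInv 𝒱 c (phi 𝒱 α a A ∘ₗ phi 𝒱 β b B) =
      (a * (e₁ ⬝ᵥ β) + α ⬝ᵥ β).negOnePow • insertion 𝒱 h α β B A := by
  refine homExtend_ext 𝒱 fun d v hv => ?_
  rw [phiInv, compShift, homExtend_apply 𝒱 _ d v hv, smul_apply, smul_apply,
    insertion_apply 𝒱 h α β B A d v hv, smul_smul, ← Int.negOnePow_add, phi, phi,
    corestriction_comp (desusp 𝒱) _ _ h _ _ (fun i => d i - e₁) v fun i => mem_desusp 𝒱 (hv i),
    Finset.smul_sum, Finset.smul_sum]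
  refine Finset.sum_congr rfl fun t _ => ?_
  -- The suspension sign of `A` can be evaluated only once the inserted value of `B` has a known
  -- degree.
  have hBv := hB _ _ fun i => hv (t.S.orderEmbOfFin t.card_S i)
  rw [unshuffleInsert, unshuffleInsert, insertMap_apply, insertMap_apply,
    signed_compShift_desusp_apply 𝒱 B _ _ fun i => hv (t.S.orderEmbOfFin t.card_S i),
    map_insertNth_units_smul, signed_compShift_desusp_apply 𝒱 A _ _ (insertNth_mem hBv fun i =>
      hv (t.Sᶜ.orderEmbOfFin (t.card_S_compl h) i)), smul_smul, smul_smul, smul_smul, smul_smul,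
    ← Int.negOnePow_add, ← Int.negOnePow_add, ← Int.negOnePow_add, ← Int.negOnePow_add]
  congr 1
  rw [Int.negOnePow_eq_iff]
  obtain ⟨r, hr⟩ := even_stem_sign h β t d
  refine ⟨r - α ⬝ᵥ β, ?_⟩
  linear_combination hr

theorem stemBracket_eq {a b : ℕ} (α β : Fin n → ℤ)
    (A : MultilinearMap K (fun _ : Fin (a + 1) => V) V) (hA : A ∈ weightMaps 𝒱 α a)
    (B : MultilinearMap K (fun _ : Fin (b + 1) => V) V) (hB : B ∈ weightMaps 𝒱 β b) :
    stemBracket 𝒱 α a β b A B =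
      insertion 𝒱 (Nat.add_comm b a) β α A B -
        (α ⬝ᵥ β + a * b).negOnePow • insertion 𝒱 rfl α β B A := by
  have hsub : phiInv 𝒱 (a + b) (gradedCommutator (α + a • e₁) (β + b • e₁)
      (phi 𝒱 α a A) (phi 𝒱 β b B)) =
      phiInv 𝒱 (a + b) (phi 𝒱 α a A ∘ₗ phi 𝒱 β b B) -
        ((α + a • e₁) ⬝ᵥ (β + b • e₁)).negOnePow •
          phiInv 𝒱 (a + b) (phi 𝒱 β b B ∘ₗ phi 𝒱 α a A) := by
    refine homExtend_ext 𝒱 fun d v hv => ?_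
    simp only [phiInv, compShift, sub_apply, smul_apply, homExtend_apply 𝒱 _ d v hv]
    rw [smul_comm, ← smul_sub]
    congr 1
    simp only [corestriction, gradedCommutator, LinearMap.compMultilinearMap_apply,
      LinearMap.comp_apply, LinearMap.sub_apply, map_sub, LinearMap.smul_apply, Units.smul_def,
      map_zsmul]
  rw [stemBracket, hsub, phiInv_phi_comp_phi 𝒱 rfl α β A B hB,
    phiInv_phi_comp_phi 𝒱 (Nat.add_comm b a) β α B A hA, smul_sub, smul_smul, smul_smul,
    smul_smul, ← Int.negOnePow_add, ← Int.negOnePow_add, ← Int.negOnePow_add]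
  have h₁ : (a • e₁ : Fin n → ℤ) ⬝ᵥ (b • e₁ + β) = a * b + a * (e₁ ⬝ᵥ β) := by
    rw [smul_dotProduct, dotProduct_add, dotProduct_smul, e₁_dotProduct_e₁]
    simp only [nsmul_eq_mul]
    ring
  have h₂ : (α + a • e₁) ⬝ᵥ (β + b • e₁) =
      α ⬝ᵥ β + b * (e₁ ⬝ᵥ α) + a * (e₁ ⬝ᵥ β) + a * b := by
    rw [add_dotProduct, dotProduct_add, dotProduct_add, smul_dotProduct, smul_dotProduct,
      dotProduct_smul, dotProduct_smul, e₁_dotProduct_e₁, dotProduct_comm α e₁]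
    simp only [nsmul_eq_mul]
    ring
  -- The two occurrences of `a⟨e₁,β⟩`, from the prefactor and from the first composite, cancel
  -- modulo 2.
  have s₁ : (1 + (a • e₁) ⬝ᵥ (b • e₁ + β) + (a * (e₁ ⬝ᵥ β) + α ⬝ᵥ β)).negOnePow =
      -(α ⬝ᵥ β + a * b).negOnePow := by
    rw [← Int.negOnePow_succ, Int.negOnePow_eq_iff, h₁]
    exact ⟨a * (e₁ ⬝ᵥ β), by ring⟩
  -- For the second composite the commutator sign makes every term except the `1` occur twice.
  have s₂ : (1 + (a • e₁) ⬝ᵥ (b • e₁ + β) + (α + a • e₁) ⬝ᵥ (β + b • e₁) +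
      (b * (e₁ ⬝ᵥ α) + β ⬝ᵥ α)).negOnePow = -1 := by
    rw [← Int.negOnePow_one, Int.negOnePow_eq_iff, h₁, h₂, dotProduct_comm β α]
    exact ⟨a * b + a * (e₁ ⬝ᵥ β) + α ⬝ᵥ β + b * (e₁ ⬝ᵥ α), by ring⟩
  rw [s₁, s₂, Units.neg_smul, Units.neg_smul, one_smul]
  abel

end StemFormula

/-! ### Weights -/

section Weight

variable {n : ℕ} {K V : Type*} [Field K] [AddCommGroup V] [Module K V]
  (𝒱 : (Fin n → ℤ) → Submodule K V)

theorem units_smul_mem {P : Submodule K V} (ε : ℤˣ) {x : V} (hx : x ∈ P) : ε • x ∈ P := by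
  rw [Units.smul_def]
  exact zsmul_mem hx _

theorem insertMap_mem {a b c : ℕ} {α β : Fin n → ℤ}
    {A : MultilinearMap K (fun _ : Fin (a + 1) => V) V} (hA : A ∈ weightMaps 𝒱 α a)
    {B : MultilinearMap K (fun _ : Fin (b + 1) => V) V} (hB : B ∈ weightMaps 𝒱 β b)
    (s : Fin (a + 1)) (S : Finset (Fin (c + 1))) (hS : S.card = b + 1) (hS' : Sᶜ.card = a) :
    insertMap A B s S hS hS' ∈ weightMaps 𝒱 (α + β) c := by
  intro d v hv
  rw [insertMap_apply]
  have h := hA _ _ (insertNth_mem (s := s) (hB _ _ fun i => hv (S.orderEmbOfFin hS i))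
    fun i => hv (Sᶜ.orderEmbOfFin hS' i))
  rw [sum_insertNth s _ _ fun _ (x : Fin n → ℤ) => x,
    sum_orderEmbOfFin S hS fun _ l => d l, sum_orderEmbOfFin Sᶜ hS' fun _ l => d l] at h
  rw [← Finset.sum_add_sum_compl S]
  convert h using 2
  abel

theorem insertion_mem [DirectSum.Decomposition 𝒱] {a b c : ℕ} (h : a + b = c) {α β : Fin n → ℤ}
    {A : MultilinearMap K (fun _ : Fin (a + 1) => V) V} (hA : A ∈ weightMaps 𝒱 α a)
    {B : MultilinearMap K (fun _ : Fin (b + 1) => V) V} (hB : B ∈ weightMaps 𝒱 β b) :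
    insertion 𝒱 h α β B A ∈ weightMaps 𝒱 (α + β) c := by
  intro d v hv
  rw [insertion_apply 𝒱 h α β B A d v hv]
  exact units_smul_mem _ (Submodule.sum_mem _ fun t _ =>
    units_smul_mem _ (insertMap_mem 𝒱 hA hB _ _ _ _ d v hv))

end Weight

/-! ### Insertions of graded skew-symmetric maps -/

section Skew

variable {n : ℕ} {K V : Type*} [Field K] [AddCommGroup V] [Module K V]
  (𝒱 : (Fin n → ℤ) → Submodule K V)

theorem insertNth_succ_eq_comp_swap {a : ℕ} {N : Type*} (s : Fin a) (x : N) (y : Fin a → N) :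
    s.succ.insertNth (α := fun _ => N) x y =
      s.castSucc.insertNth (α := fun _ => N) x y ∘ Equiv.swap s.castSucc s.succ := by
  funext r
  revert r
  rw [Fin.forall_iff_succAbove s.succ]
  refine ⟨by simp, fun i => ?_⟩
  rw [Fin.insertNth_apply_succAbove, Function.comp_apply]
  rcases eq_or_ne i s with rfl | hi
  · have h : i.castSucc.succAbove i = i.succ := Fin.succAbove_castSucc_self i
    rw [Fin.succAbove_succ_self, Equiv.swap_apply_left, ← h, Fin.insertNth_apply_succAbove]
  · have h : s.succ.succAbove i = s.castSucc.succAbove i := by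
      rcases lt_or_gt_of_ne hi with hi | hi
      · rw [Fin.succAbove_of_castSucc_lt _ _ (Fin.castSucc_lt_castSucc_iff.2 hi),
          Fin.succAbove_of_castSucc_lt _ _ (Fin.lt_def.2 (by
            have := Fin.lt_def.1 hi
            simp; omega))]
      · rw [Fin.succAbove_of_le_castSucc _ _ (Fin.le_def.2 (by
            have := Fin.lt_def.1 hi
            simp; omega)),
          Fin.succAbove_of_le_castSucc _ _ (Fin.castSucc_le_castSucc_iff.2 hi.le)]
    rw [h, Equiv.swap_apply_of_ne_of_ne (Fin.succAbove_ne _ _) (h ▸ Fin.succAbove_ne _ _),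
      Fin.insertNth_apply_succAbove]

/-- The inserted vector moves left one slot at a time; each argument it passes contributes `-1` and
the Koszul sign of the two degrees. -/
theorem IsGradedSkew.apply_insertNth {a : ℕ} {A : MultilinearMap K (fun _ : Fin (a + 1) => V) V}
    (hA : IsGradedSkew 𝒱 A) {x : V} {δ : Fin n → ℤ} {y : Fin a → V} {d : Fin a → Fin n → ℤ}
    (hx : x ∈ 𝒱 δ) (hy : ∀ i, y i ∈ 𝒱 (d i)) (s : Fin (a + 1)) :
    A (s.insertNth (α := fun _ => V) x y) =
      ((s : ℕ) + δ ⬝ᵥ ∑ i ∈ Finset.univ.filter fun i : Fin a => (i : ℕ) < s, d i).negOnePow •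
        A ((0 : Fin (a + 1)).insertNth (α := fun _ => V) x y) := by
  induction s using Fin.induction with
  | zero => simp
  | succ s ih =>
    have hd₁ : s.castSucc.insertNth (α := fun _ => Fin n → ℤ) δ d s.castSucc = δ := by simp
    have hd₂ : s.castSucc.insertNth (α := fun _ => Fin n → ℤ) δ d s.succ = d s := by
      have h : s.castSucc.succAbove s = s.succ := Fin.succAbove_castSucc_self s
      rw [← h, Fin.insertNth_apply_succAbove]
    have hsum : ∑ i ∈ Finset.univ.filter fun i : Fin a => (i : ℕ) < (s.succ : Fin (a + 1)), d i =
        d s + ∑ i ∈ Finset.univ.filter fun i : Fin a =>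
          (i : ℕ) < (s.castSucc : Fin (a + 1)), d i := by
      rw [← Finset.sum_insert (by simp)]
      congr 1
      ext i
      simp [Fin.ext_iff]
      omega
    rw [insertNth_succ_eq_comp_swap, hA _ _ (insertNth_mem hx hy) s.castSucc s.succ (by simp),
      hd₁, hd₂, ih, smul_smul, ← Units.neg_smul, hsum, dotProduct_add, ← Int.negOnePow_add,
      ← Int.negOnePow_succ]
    congr 2
    simp
    ring

namespace Unshuffle

variable {a b c : ℕ}

theorem bijective_S : Function.Bijective fun t : Unshuffle c b =>
    (⟨t.S, t.card_S⟩ : {S : Finset (Fin (c + 1)) // S.card = b + 1}) := by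
  constructor
  · intro t t' h
    have hS : t.S = t'.S := congrArg Subtype.val h
    have hk : t.k₁ = t'.k₁ :=
      le_antisymm (t'.le_k₁ (hS ▸ t.k₁_mem_S)) (t.le_k₁ (hS.symm ▸ t'.k₁_mem_S))
    have hJ : ∀ u : Unshuffle c b, u.J = u.S.erase u.k₁ := fun u => by
      exact (Finset.erase_insert fun h => lt_irrefl _ (u.2.1 _ h)).symm
    refine Subtype.ext (Prod.ext hk ?_)
    change t.J = t'.J
    rw [hJ, hJ, hS, hk]
  · rintro ⟨S, hS⟩
    have hne : S.Nonempty := Finset.card_pos.1 (by omega)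
    refine ⟨⟨(S.max' hne, S.erase (S.max' hne)), fun j hj => ?_, ?_⟩, Subtype.ext ?_⟩
    · exact lt_of_le_of_ne (S.le_max' _ (Finset.mem_of_mem_erase hj)) (Finset.ne_of_mem_erase hj)
    · rw [Finset.card_erase_of_mem (S.max'_mem hne), hS, Nat.add_sub_cancel]
    · exact Finset.insert_erase (S.max'_mem hne)

/-- Every pair of an element of `I` and one of `S` is an inversion of `(I;S)` or of `(S;Sᶜ)`, and
conversely. -/
theorem sum_inversion_add {M : Type*} [AddCommMonoid M] (t : Unshuffle c b)
    (g : Fin (c + 1) → Fin (c + 1) → M) (hg : ∀ i j, g i j = g j i) :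
    ∑ i ∈ t.I, ∑ j ∈ t.S, (if j < i then g i j else 0) +
      ∑ i ∈ t.S, ∑ j ∈ t.Sᶜ, (if j < i then g i j else 0) = ∑ i ∈ t.I, ∑ j ∈ t.S, g i j := by
  -- The elements of the complement beyond `k₁` exceed all of `S` and give no inversions.
  have h : ∑ i ∈ t.S, ∑ j ∈ t.Sᶜ, (if j < i then g i j else 0) =
      ∑ i ∈ t.S, ∑ j ∈ t.I, (if j < i then g i j else 0) := by
    refine Finset.sum_congr rfl fun i hi => (Finset.sum_subset (fun j hj => (t.mem_I.1 hj).1)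
      fun j hj hj' => if_neg ?_).symm
    exact ((t.le_k₁ hi).trans (t.k₁_lt hj hj').le).not_gt
  rw [h, Finset.sum_comm (s := t.S), ← Finset.sum_add_distrib]
  refine Finset.sum_congr rfl fun i hi => ?_
  rw [← Finset.sum_add_distrib]
  refine Finset.sum_congr rfl fun j hj => ?_
  have hne : i ≠ j := by
    rintro rfl
    exact Finset.mem_compl.1 (t.mem_I.1 hi).1 hj
  rcases lt_or_gt_of_ne hne with hlt | hlt
  · rw [if_neg hlt.le.not_gt, if_pos hlt, zero_add, hg]
  · rw [if_pos hlt, if_neg hlt.le.not_gt, add_zero]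

theorem inversions_add (t : Unshuffle c b) :
    inversions t.I t.J + inversions t.S t.Sᶜ = t.I.card * (b + 1) := by
  rw [t.inversions_I_J, inversions, inversions, t.sum_inversion_add (fun _ _ => 1) fun _ _ => rfl]
  simp [t.card_S]

theorem koszul_add (t : Unshuffle c b) (d : Fin (c + 1) → Fin n → ℤ) :
    koszul d t.I t.J + koszul d t.S t.Sᶜ = (∑ i ∈ t.I, d i) ⬝ᵥ ∑ j ∈ t.S, d j := by
  rw [t.koszul_I_J, koszul, koszul,
    t.sum_inversion_add (fun i j => d i ⬝ᵥ d j) fun i j => dotProduct_comm _ _, sum_dotProduct]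
  simp only [dotProduct_sum]

end Unshuffle

theorem IsGradedSkew.unshuffleInsert_apply {a b c : ℕ} (h : a + b = c) {β : Fin n → ℤ}
    {A : MultilinearMap K (fun _ : Fin (a + 1) => V) V} (hA : IsGradedSkew 𝒱 A)
    {B : MultilinearMap K (fun _ : Fin (b + 1) => V) V} (hB : B ∈ weightMaps 𝒱 β b)
    (t : Unshuffle c b) (d : Fin (c + 1) → Fin n → ℤ) (v : Fin (c + 1) → V)
    (hv : ∀ i, v i ∈ 𝒱 (d i)) :
    unshuffleInsert h A B t v =
      (t.I.card + (∑ i ∈ t.S, d i + β) ⬝ᵥ ∑ i ∈ t.I, d i).negOnePow •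
        insertMap A B 0 t.S t.card_S (t.card_S_compl h) v := by
  -- Among the arguments outside `S`, those of `I` come first, the others lying beyond `k₁`.
  have hI : ∑ i ∈ Finset.univ.filter fun i : Fin a => (i : ℕ) < t.I.card,
      d (t.Sᶜ.orderEmbOfFin (t.card_S_compl h) i) =
      ∑ i ∈ t.I, d i := by
    rw [t.I_eq_filter, Finset.sum_filter, Finset.sum_filter, ← t.I_eq_filter,
      sum_orderEmbOfFin t.Sᶜ (t.card_S_compl h) fun i l => if i < t.I.card then d l else 0]
    refine Finset.sum_congr rfl fun l hl => if_congr ?_ rfl rfl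
    constructor
    · intro hlt
      by_contra hk
      refine hlt.not_ge (Finset.card_le_card fun x hx => Finset.mem_filter.2 ⟨(t.mem_I.1 hx).1, ?_⟩)
      exact (t.lt_k₁ hx).trans (t.k₁_lt hl fun h => hk (t.lt_k₁ h))
    · intro hk
      refine Finset.card_lt_card (Finset.ssubset_iff_of_subset ?_ |>.2
        ⟨l, t.mem_I.2 ⟨hl, hk⟩, by simp⟩)
      exact fun x hx => t.mem_I.2
        ⟨(Finset.mem_filter.1 hx).1, (Finset.mem_filter.1 hx).2.trans hk⟩
  rw [unshuffleInsert, insertMap_apply, insertMap_apply,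
    hA.apply_insertNth 𝒱 (hB _ _ fun i => hv (t.S.orderEmbOfFin t.card_S i))
      (fun i => hv (t.Sᶜ.orderEmbOfFin (t.card_S_compl h) i)), hI,
    sum_orderEmbOfFin t.S t.card_S fun _ l => d l]

theorem insertion_eq_interior [DirectSum.Decomposition 𝒱] {a b c : ℕ} (h : a + b = c)
    (α β : Fin n → ℤ) {A : MultilinearMap K (fun _ : Fin (a + 1) => V) V}
    (hA : IsGradedSkew 𝒱 A) {B : MultilinearMap K (fun _ : Fin (b + 1) => V) V}
    (hB : B ∈ weightMaps 𝒱 β b) :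
    insertion 𝒱 h α β B A = interior 𝒱 h α β B A := by
  refine homExtend_ext 𝒱 fun d v hv => ?_
  rw [insertion_apply 𝒱 h α β B A d v hv, interior, smul_apply, homExtend_apply 𝒱 _ d v hv,
    sum_apply]
  congr 1
  refine Fintype.sum_bijective _ Unshuffle.bijective_S _ _ fun t => ?_
  rw [smul_apply, hA.unshuffleInsert_apply 𝒱 h hB t d v hv, smul_smul, ← Int.negOnePow_add]
  congr 1
  rw [Int.negOnePow_eq_iff]
  have h₁ := t.inversions_add
  have h₂ := t.koszul_add d
  have h₃ : (∑ i ∈ t.S, d i) ⬝ᵥ ∑ i ∈ t.I, d i = (∑ i ∈ t.I, d i) ⬝ᵥ ∑ i ∈ t.S, d i :=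
    dotProduct_comm _ _
  -- By `inversions_add` and `koszul_add` the difference of the exponents is twice this witness.
  refine ⟨β ⬝ᵥ (∑ i ∈ t.I, d i) + inversions t.I t.J + koszul d t.I t.J, ?_⟩
  rw [add_dotProduct]
  linear_combination h₃ - h₁ - h₂

end Skew

/-! ### Adjacent transpositions and subsets -/

section Transposition

variable {m : ℕ} {p q : Fin m}

theorem swap_lt_swap (hpq : (p : ℕ) + 1 = q) {x y : Fin m} (hxy : x < y)
    (h : ¬ (x = p ∧ y = q)) : Equiv.swap p q x < Equiv.swap p q y := by
  rw [Equiv.swap_apply_def, Equiv.swap_apply_def]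
  split_ifs <;> simp only [Fin.lt_def, Fin.ext_iff, not_and] at * <;> omega

theorem orderEmbOfFin_map_swap (hpq : (p : ℕ) + 1 = q) {S S' : Finset (Fin m)}
    (hS' : S' = S.map (Equiv.swap p q).toEmbedding) (hpS : ¬ (p ∈ S ∧ q ∈ S)) {k : ℕ}
    (h : S.card = k) (h' : S'.card = k) (i : Fin k) :
    S'.orderEmbOfFin h' i = Equiv.swap p q (S.orderEmbOfFin h i) := by
  have := Finset.orderEmbOfFin_unique h' (f := fun i => Equiv.swap p q (S.orderEmbOfFin h i))
    (fun i => by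
      rw [hS', Finset.mem_map_equiv, Equiv.symm_apply_apply]
      exact Finset.orderEmbOfFin_mem _ _ _)
    fun i j hij => swap_lt_swap hpq ((S.orderEmbOfFin h).strictMono hij) fun hc => hpS
      ⟨hc.1 ▸ Finset.orderEmbOfFin_mem _ _ _, hc.2 ▸ Finset.orderEmbOfFin_mem _ _ _⟩
  exact (congrFun this i).symm

theorem exists_adjacent_positions (hpq : (p : ℕ) + 1 = q) {S : Finset (Fin m)} (hp : p ∈ S)
    (hq : q ∈ S) {k : ℕ} (h : S.card = k) :
    ∃ i j : Fin k, (i : ℕ) + 1 = j ∧ S.orderEmbOfFin h i = p ∧ S.orderEmbOfFin h j = q := by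
  have hr : ∀ x ∈ S, ∃ i, S.orderEmbOfFin h i = x := fun x hx => by
    rw [← Set.mem_range, Finset.range_orderEmbOfFin]
    exact hx
  obtain ⟨i, hi⟩ := hr p hp
  obtain ⟨j, hj⟩ := hr q hq
  refine ⟨i, j, ?_, hi, hj⟩
  have hi' := card_filter_lt_orderEmbOfFin S h i
  have hj' := card_filter_lt_orderEmbOfFin S h j
  rw [hi] at hi'
  rw [hj] at hj'
  have : (S.filter fun x => x < q) = insert p (S.filter fun x => x < p) := by
    ext x
    simp only [Finset.mem_filter, Finset.mem_insert, Fin.lt_def, Fin.ext_iff]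
    constructor
    · rintro ⟨hx, hlt⟩
      by_cases hxp : (x : ℕ) = p
      · exact Or.inl hxp
      · exact Or.inr ⟨hx, by omega⟩
    · rintro (hx | ⟨hx, hlt⟩)
      · exact ⟨Fin.ext hx ▸ hp, by omega⟩
      · exact ⟨hx, by omega⟩
  rw [this, Finset.card_insert_of_notMem (by simp)] at hj'
  omega

/-- An adjacent transposition preserves the order of every pair except `{p, q}`, so inversion sums
differ only by the contribution of that pair. -/
theorem sum_inversion_map_swap (hpq : (p : ℕ) + 1 = q) (S T : Finset (Fin m)) (hST : Disjoint S T)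
    (g : Fin m → Fin m → ℤ) (hg : ∀ i j, g i j = g j i) :
    ∑ i ∈ S.map (Equiv.swap p q).toEmbedding, ∑ j ∈ T.map (Equiv.swap p q).toEmbedding,
        (if j < i then g i j else 0) + (if q ∈ S ∧ p ∈ T then g p q else 0) =
      ∑ i ∈ S, ∑ j ∈ T, (if j < i then g (Equiv.swap p q i) (Equiv.swap p q j) else 0) +
        (if p ∈ S ∧ q ∈ T then g p q else 0) := by
  -- Written as double sums supported at one pair, the corrections can be compared pair by pair.
  have hsingle : ∀ x y : Fin m, (if x ∈ S ∧ y ∈ T then g p q else 0) =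
      ∑ i ∈ S, ∑ j ∈ T, if i = x ∧ j = y then g p q else 0 := fun x y => by
    simp only [ite_and, Finset.sum_ite_irrel, Finset.sum_ite_eq', Finset.sum_const_zero]
  rw [hsingle, hsingle, Finset.sum_map, ← Finset.sum_add_distrib, ← Finset.sum_add_distrib]
  refine Finset.sum_congr rfl fun i hi => ?_
  rw [Finset.sum_map, ← Finset.sum_add_distrib, ← Finset.sum_add_distrib]
  refine Finset.sum_congr rfl fun j hj => ?_
  have hne : i ≠ j := Finset.disjoint_iff_ne.1 hST i hi j hj
  have hlt : p < q := Fin.lt_def.2 (by omega)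
  simp only [Equiv.coe_toEmbedding]
  by_cases h₁ : i = p ∧ j = q
  · obtain ⟨rfl, rfl⟩ := h₁
    simp [hlt, hlt.le.not_gt, hne, hne.symm, hg]
  by_cases h₂ : i = q ∧ j = p
  · obtain ⟨rfl, rfl⟩ := h₂
    simp [hlt, hlt.le.not_gt, hne, hg]
  rw [if_neg h₁, if_neg h₂, add_zero, add_zero]
  refine if_congr ?_ rfl rfl
  rcases lt_or_gt_of_ne hne with hij | hij
  · exact iff_of_false (swap_lt_swap hpq hij h₁).le.not_gt hij.le.not_gt
  · exact iff_of_true (swap_lt_swap hpq hij fun h => h₂ h.symm) hij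

end Transposition

/-! ### Skew-symmetry of the Nijenhuis–Richardson bracket -/

section Skew

variable {n : ℕ} {K V : Type*} [Field K] [AddCommGroup V] [Module K V]
  (𝒱 : (Fin n → ℤ) → Submodule K V)

theorem IsGradedSkew.sub {p : ℕ} {f g : MultilinearMap K (fun _ : Fin p => V) V}
    (hf : IsGradedSkew 𝒱 f) (hg : IsGradedSkew 𝒱 g) : IsGradedSkew 𝒱 (f - g) := by
  intro d v hv i j hij
  rw [sub_apply, sub_apply, hf d v hv i j hij, hg d v hv i j hij, smul_sub]
  abel

theorem IsGradedSkew.units_smul {p : ℕ} {f : MultilinearMap K (fun _ : Fin p => V) V}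
    (hf : IsGradedSkew 𝒱 f) (ε : ℤˣ) : IsGradedSkew 𝒱 (ε • f) := by
  intro d v hv i j hij
  rw [smul_apply, smul_apply, hf d v hv i j hij, smul_neg, smul_comm]

theorem insertMap_zero_comp_swap {a b c : ℕ} {β : Fin n → ℤ}
    {A : MultilinearMap K (fun _ : Fin (a + 1) => V) V} (hA : IsGradedSkew 𝒱 A)
    {B : MultilinearMap K (fun _ : Fin (b + 1) => V) V} (hBβ : B ∈ weightMaps 𝒱 β b)
    (hB : IsGradedSkew 𝒱 B) (d : Fin (c + 1) → Fin n → ℤ) (v : Fin (c + 1) → V)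
    (hv : ∀ i, v i ∈ 𝒱 (d i)) {p q : Fin (c + 1)} (hpq : (p : ℕ) + 1 = q)
    {S S' : Finset (Fin (c + 1))} (hS : S.card = b + 1) (hSc : Sᶜ.card = a)
    (hS' : S'.card = b + 1) (hSc' : S'ᶜ.card = a)
    (hmap : S' = S.map (Equiv.swap p q).toEmbedding) :
    (inversions S Sᶜ + koszul (d ∘ Equiv.swap p q) S Sᶜ).negOnePow •
        insertMap A B 0 S hS hSc (v ∘ Equiv.swap p q) =
      -((d p ⬝ᵥ d q).negOnePow • (inversions S' S'ᶜ + koszul d S' S'ᶜ).negOnePow •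
        insertMap A B 0 S' hS' hSc' v) := by
  have hmapc : S'ᶜ = Sᶜ.map (Equiv.swap p q).toEmbedding := by
    ext x
    rw [hmap, Finset.mem_compl, Finset.mem_map_equiv, Finset.mem_map_equiv, Finset.mem_compl]
  have hinv := sum_inversion_map_swap hpq S Sᶜ disjoint_compl_right (fun _ _ => 1) fun _ _ => rfl
  have hkos := sum_inversion_map_swap hpq S Sᶜ disjoint_compl_right (fun i j => d i ⬝ᵥ d j)
    fun i j => dotProduct_comm _ _
  rw [← hmap, ← hmapc] at hinv hkos
  change inversions S' S'ᶜ + _ = inversions S Sᶜ + _ at hinv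
  change koszul d S' S'ᶜ + _ = koszul (d ∘ Equiv.swap p q) S Sᶜ + _ at hkos
  have hcompl : ∀ x, x ∈ Sᶜ ↔ x ∉ S := fun x => Finset.mem_compl
  -- If `S` does not separate `p` and `q`, it is stable under the transposition, and the sign must
  -- come from `B` or from `A`.
  by_cases hiff : p ∈ S ↔ q ∈ S
  · have hSS : S' = S := by
      rw [hmap]
      ext x
      rw [Finset.mem_map_equiv, Equiv.symm_swap, Equiv.swap_apply_def]
      split_ifs with h₁ h₂
      · rw [h₁, hiff]
      · rw [h₂, hiff]
      · rfl
    rw [if_neg (by rw [hcompl, hiff]; tauto), if_neg (by rw [hcompl, hiff]; tauto), add_zero,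
      add_zero] at hinv hkos
    rw [hinv, hkos, smul_comm, ← smul_neg]
    congr 1
    subst hSS
    have hne : ∀ T : Finset (Fin (c + 1)), p ∉ T → q ∉ T → ∀ (k : ℕ) (hT : T.card = k) (i : Fin k),
        Equiv.swap p q (T.orderEmbOfFin hT i) = T.orderEmbOfFin hT i := fun T hp hq k hT i =>
      Equiv.swap_apply_of_ne_of_ne
        (fun h => hp (h ▸ Finset.orderEmbOfFin_mem _ _ _))
        (fun h => hq (h ▸ Finset.orderEmbOfFin_mem _ _ _))
    rw [insertMap_apply, insertMap_apply]
    by_cases hp : p ∈ S'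
    · have hq := hiff.1 hp
      obtain ⟨i, j, hij, hi, hj⟩ := exists_adjacent_positions hpq hp hq hS
      have hc : (fun r => (v ∘ Equiv.swap p q) (S'.orderEmbOfFin hS r)) =
          (fun r => v (S'.orderEmbOfFin hS r)) ∘ Equiv.swap i j := by
        funext r
        rw [Function.comp_apply, Function.comp_apply,
          (S'.orderEmbOfFin hS).injective.map_swap, hi, hj]
      simp only [Function.comp_apply (f := v),
        hne S'ᶜ (by simpa using hp) (by simpa using hq)] at hc ⊢
      rw [hc, hB _ _ (fun r => hv (S'.orderEmbOfFin hS r)) i j hij, hi, hj, ← Units.neg_smul,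
        map_insertNth_units_smul, Units.neg_smul]
    · have hq := fun h => hp (hiff.2 h)
      obtain ⟨i, j, hij, hi, hj⟩ := exists_adjacent_positions hpq
        (Finset.mem_compl.2 hp) (Finset.mem_compl.2 hq) hSc
      simp only [Function.comp_apply (f := v), hne S' hp hq]
      -- The value of `B` occupies slot 0, so the exchanged arguments of `A` sit at the successors
      -- of their positions in the complement.
      have hc : (0 : Fin (a + 1)).insertNth (α := fun _ => V)
          (B fun r => v (S'.orderEmbOfFin hS r))
          (fun r => v (Equiv.swap p q (S'ᶜ.orderEmbOfFin hSc r))) =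
          (0 : Fin (a + 1)).insertNth (α := fun _ => V) (B fun r => v (S'.orderEmbOfFin hS r))
            (fun r => v (S'ᶜ.orderEmbOfFin hSc r)) ∘ Equiv.swap i.succ j.succ := by
        funext r
        refine Fin.cases ?_ (fun r => ?_) r
        · rw [Function.comp_apply, Equiv.swap_apply_of_ne_of_ne (Fin.succ_ne_zero _).symm
            (Fin.succ_ne_zero _).symm]
          simp
        · rw [Function.comp_apply, ← (Fin.succ_injective a).map_swap]
          simp [(S'ᶜ.orderEmbOfFin hSc).injective.map_swap, hi, hj]
      rw [hc, hA _ _ (insertNth_mem (hBβ _ _ fun r => hv (S'.orderEmbOfFin hS r))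
        fun r => hv (S'ᶜ.orderEmbOfFin hSc r)) i.succ j.succ (by simp [← hij])]
      simp [hi, hj]
  -- When `S` separates `p` and `q`, both sides evaluate `A` and `B` on the same families; the sign
  -- is the pair `{p, q}` becoming or ceasing to be an inversion.
  · have hval : insertMap A B 0 S hS hSc (v ∘ Equiv.swap p q) = insertMap A B 0 S' hS' hSc' v := by
      rw [insertMap_apply, insertMap_apply]
      simp only [orderEmbOfFin_map_swap hpq hmap (by tauto) hS hS',
        orderEmbOfFin_map_swap hpq hmapc (by simp only [Finset.mem_compl]; tauto) hSc hSc',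
        Function.comp_apply]
    rw [hval, smul_smul, ← Units.neg_smul, ← Int.negOnePow_add, ← Int.negOnePow_succ]
    congr 1
    rw [Int.negOnePow_eq_iff]
    by_cases hp : p ∈ S
    · have hq : q ∉ S := by tauto
      rw [if_neg (by tauto), if_pos ⟨hp, (hcompl q).2 hq⟩] at hinv hkos
      exact ⟨-1 - d p ⬝ᵥ d q, by linear_combination - hinv - hkos⟩
    · have hq : q ∈ S := by tauto
      rw [if_pos ⟨hq, (hcompl p).2 hp⟩, if_neg (by tauto)] at hinv hkos
      exact ⟨0, by linear_combination - hinv - hkos⟩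

theorem interior_isGradedSkew [DirectSum.Decomposition 𝒱] {a b c : ℕ} (h : a + b = c)
    (α β : Fin n → ℤ) {A : MultilinearMap K (fun _ : Fin (a + 1) => V) V}
    (hA : IsGradedSkew 𝒱 A) {B : MultilinearMap K (fun _ : Fin (b + 1) => V) V}
    (hBβ : B ∈ weightMaps 𝒱 β b) (hB : IsGradedSkew 𝒱 B) :
    IsGradedSkew 𝒱 (interior 𝒱 h α β B A) := by
  refine IsGradedSkew.units_smul 𝒱 ?_ _
  intro d v hv p q hpq
  rw [homExtend_apply 𝒱 _ d v hv, homExtend_apply 𝒱 _ (d ∘ Equiv.swap p q)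
      (v ∘ Equiv.swap p q) fun i => hv _,
    sum_apply, sum_apply, Finset.smul_sum, ← Finset.sum_neg_distrib]
  -- The term of `S` at the exchanged arguments corresponds to the term of the transposed subset at
  -- the original ones.
  refine Fintype.sum_equiv ((Equiv.swap p q).finsetCongr.subtypeEquiv fun S => by simp) _ _
    fun S => ?_
  rw [smul_apply, smul_apply]
  exact insertMap_zero_comp_swap 𝒱 hA hBβ hB d v hv hpq _ _ _ _ rfl

end Skew

end Stem

end

open Stem in
theorem mainTheorem6 {n : ℕ} [NeZero n] {K V : Type*} [Field K] [CharZero K]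
    [AddCommGroup V] [Module K V]
    (𝒱 : (Fin n → ℤ) → Submodule K V) [DirectSum.Decomposition 𝒱]
    (α β : Fin n → ℤ) (a b : ℕ)
    (A : MultilinearMap K (fun _ : Fin (a + 1) => V) V) (hA : A ∈ weightMaps 𝒱 α a)
    (B : MultilinearMap K (fun _ : Fin (b + 1) => V) V) (hB : B ∈ weightMaps 𝒱 β b) :
    stemBracket 𝒱 α a β b A B ∈ weightMaps 𝒱 (α + β) (a + b) ∧
    stemBracket 𝒱 α a β b A B =
      insertion 𝒱 (Nat.add_comm b a) β α A B -
        (α ⬝ᵥ β + a * b).negOnePow • insertion 𝒱 rfl α β B A ∧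
    (IsGradedSkew 𝒱 A → IsGradedSkew 𝒱 B →
      IsGradedSkew 𝒱 (stemBracket 𝒱 α a β b A B) ∧
      stemBracket 𝒱 α a β b A B = nrBracket 𝒱 α a β b A B) := by
  have hst := stemBracket_eq 𝒱 α β A hA B hB
  refine ⟨?_, hst, fun hAs hBs => ?_⟩
  · rw [hst]
    have h := insertion_mem 𝒱 (Nat.add_comm b a) hB hA
    rw [add_comm β α] at h
    refine Submodule.sub_mem _ h ?_
    rw [Units.smul_def]
    exact zsmul_mem (insertion_mem 𝒱 rfl hA hB) _
  · have hnr : stemBracket 𝒱 α a β b A B = nrBracket 𝒱 α a β b A B := by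
      rw [hst, insertion_eq_interior 𝒱 _ β α hBs hA, insertion_eq_interior 𝒱 _ α β hAs hB,
        nrBracket]
    refine ⟨?_, hnr⟩
    rw [hnr]
    exact (interior_isGradedSkew 𝒱 _ β α hBs hA hAs).sub 𝒱
      ((interior_isGradedSkew 𝒱 _ α β hAs hB hBs).units_smul 𝒱 _)
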